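/- Setting. A configuration over a finite set $A$ is a map $c:\mathbb Z^2\to A$; it is integral if $A\subset\mathbb Z$. A vector $\vec t\in\mathbb Z^2$ is a period of $c$ if $c_{\vec u-\vec t}=c_{\vec u}$ for all $\vec u\in\mathbb Z^2$. The configuration $c$ is periodic if it has a non-zero period, periodic in direction $\vec v\in\mathbb Z^2\setminus\{\vec 0\}$ if $k\vec v$ is a period for some non-zero integer $k$, and two-periodic if it has two linearly independent periods. A Laurent polynomial is a line polynomial (in direction $\vec v$) if its support has at least two points and is contained in $\vec u+\mathbb Q\vec v$ for some $\vec u \in\mathbb Z^2$. A vector in $\mathbb Z^2$ is primitive if its components are relatively prime. Factors of $f\in\mathbb Z[x^{\pm1},y^{\pm1}]$ are taken in $\mathbb Z[x^{\pm1},y^{\pm1}]$. The vector presentation $c'$ of a configuration $c$ over $A=\{a_1,\dots,a_n\}$ is defined by $c'_{\vec u}=\vec e_i$ if $c_{\vec u}=a_i$, where $\vec e_1,\dots,\vec e_n$ is the standard basis of $\mathbb Z^n$. For $f=\sum_{\vec w} f_{\vec w}X^{\vec w}\in\mathbb Z[x^{\pm1},y^{\pm1}]$, where $X^{\vec w}=x^{w_1}y^{w_2}$,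 the abelian complexity $A(c,f)$ is the number of distinct coefficients of the formal product $(\mathbf I f)c'$, where $\mathbf I$ is the $n\times n$ identity matrix, that is, the number of distinct vectors $\sum_{\vec w}f_{\vec w}\,c'_{\vec u-\vec w}$, $\vec u\in\mathbb Z^2$. For a finite set $D\subset\mathbb Z^2$, the abelian complexity $A(c,D)$ is the number of patterns of shape $D$ that appear in $c$, where two patterns are identified if every symbol of $A$ occurs equally often in both. Put $f_D=\sum_{\vec u\in D}X^{-\vec u}$. Theorem. (1) Let $c$ be a two-dimensional integral configuration (over a finite alphabet $A\subset\mathbb Z$) and let $f\in\mathbb Z[x^{\pm1},y^{\pm1}]$ satisfy $A(c,f)=1$. If $f$ has no line polynomial factors, then $c$ is two-periodic. If $\vec v$ is a primitive vector and all line polynomial factors of $f$ are in direction $\vec v$, then $c$ is periodic in direction $\vec v$. (2) Let $D\subset\mathbb Z^2$ be finite and let $c$ be a two-dimensional configuration over any finite alphabet with $A(c,D)=1$. If $f_D$ has no line polynomial factors, then $c$ is two-periodic. If all line polynomial factors of $f_D$ are in one primitive direction, then $c$ is periodic. No convexity of the support of $f$ or of $D$ is assumed. -/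

import Mathlib

/-- Laurent polynomials in two variables over a semiring `R`: the monomial `x ^ i * y ^ j`
has exponent `(i, j) : ℤ × ℤ`. -/
abbrev LaurentPoly₂ (R : Type*) [Semiring R] : Type _ := AddMonoidAlgebra R (ℤ × ℤ)

namespace LaurentPoly₂

/-- `f` is a line polynomial in direction `v`: its support has at least two points and is
contained in `u + ℚ v` for some `u`. -/
def IsLinePolynomialInDirection {R : Type*} [Semiring R] (f : LaurentPoly₂ R) (v : ℤ × ℤ) :
    Prop :=
  2 ≤ f.coeff.support.card ∧
    ∃ u : ℤ × ℤ, ∀ w ∈ f.coeff.support,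
      ∃ q : ℚ, (w.1 : ℚ) = u.1 + q * v.1 ∧ (w.2 : ℚ) = u.2 + q * v.2

/-- `f` is a line polynomial (in some direction). -/
def IsLinePolynomial {R : Type*} [Semiring R] (f : LaurentPoly₂ R) : Prop :=
  ∃ v : ℤ × ℤ, IsLinePolynomialInDirection f v

/-- `f` has no line polynomial factors. -/
def HasNoLineFactors {R : Type*} [CommRing R] (f : LaurentPoly₂ R) : Prop :=
  ∀ φ : LaurentPoly₂ R, φ ∣ f → ¬ IsLinePolynomial φ

/-- All line polynomial factors of `f` (if any) are in direction `v`. -/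
def AllLineFactorsInDirection {R : Type*} [CommRing R] (f : LaurentPoly₂ R) (v : ℤ × ℤ) : Prop :=
  ∀ φ : LaurentPoly₂ R, φ ∣ f → IsLinePolynomial φ → IsLinePolynomialInDirection φ v

/-- The characteristic polynomial `f_D = ∑_{u ∈ D} X ^ (-u)` of a finite shape `D`. -/
noncomputable def charPoly (D : Finset (ℤ × ℤ)) : LaurentPoly₂ ℤ :=
  ∑ u ∈ D, AddMonoidAlgebra.single (-u) 1

/-- The polynomial `I · f = ∑ f_u I X ^ u` with integer matrix coefficients. -/
noncomputable def scalarMatrixPoly (ι : Type*) [Fintype ι] [DecidableEq ι] (f : LaurentPoly₂ ℤ) :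
    LaurentPoly₂ (Matrix ι ι ℤ) :=
  AddMonoidAlgebra.mapRingHom (ℤ × ℤ) (Matrix.scalar ι) f

end LaurentPoly₂

/-- A vector of integers is primitive if its components are relatively prime. -/
def IsPrimitiveVector (v : ℤ × ℤ) : Prop := IsCoprime v.1 v.2

namespace Configuration₂

/-- The translation of `c` by `t`. -/
def translate {α : Type*} (t : ℤ × ℤ) (c : ℤ × ℤ → α) : ℤ × ℤ → α := fun u => c (u - t)

/-- `t` is a vector of periodicity of `c`. -/
def HasPeriod {α : Type*} (c : ℤ × ℤ → α) (t : ℤ × ℤ) : Prop := translate t c = c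

/-- `c` is periodic: it has a non-zero vector of periodicity. -/
def IsPeriodic {α : Type*} (c : ℤ × ℤ → α) : Prop := ∃ t : ℤ × ℤ, t ≠ 0 ∧ HasPeriod c t

/-- `c` is periodic in direction `v`: some non-zero integer multiple of `v` is a vector of
periodicity of `c`. -/
def IsPeriodicInDirection {α : Type*} (c : ℤ × ℤ → α) (v : ℤ × ℤ) : Prop :=
  ∃ k : ℤ, k ≠ 0 ∧ HasPeriod c (k • v)

/-- `c` is two-periodic: it has two linearly independent vectors of periodicity. -/
def IsTwoPeriodic {α : Type*} (c : ℤ × ℤ → α) : Prop :=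
  ∃ s t : ℤ × ℤ, LinearIndependent ℤ ![s, t] ∧ HasPeriod c s ∧ HasPeriod c t

/-- The formal product `f c` of a Laurent polynomial `f` over `R` and a formal power series `c`
with coefficients in an `R`-module: `(f c)_u = ∑_w f_w c_{u - w}`. -/
noncomputable def formalProduct {R M : Type*} [Semiring R] [AddCommMonoid M] [Module R M]
    (f : LaurentPoly₂ R) (c : ℤ × ℤ → M) : ℤ × ℤ → M :=
  fun u => ∑ w ∈ f.coeff.support, f.coeff w • c (u - w)

/-- The vector presentation of `c`: the color `a` is replaced by the base vector `e_a`. The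
coordinates are indexed by the alphabet itself. -/
def vectorPresentation {α : Type*} [DecidableEq α] (c : ℤ × ℤ → α) : ℤ × ℤ → (α → ℤ) :=
  fun u => Pi.single (c u) 1

/-- The abelian complexity `A(c, F)` of an integral vector configuration with respect to a
polynomial with matrix coefficients: the number of distinct coefficients of `F c`. -/
noncomputable def vectorAbelianComplexity {ι : Type*} [Fintype ι] [DecidableEq ι]
    (c : ℤ × ℤ → (ι → ℤ)) (F : LaurentPoly₂ (Matrix ι ι ℤ)) : ℕ∞ :=
  (Set.range (formalProduct F c)).encard

/-- The abelian complexity `A(c, f)` of a configuration with respect to an integer polynomial. -/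
noncomputable def abelianComplexity {α : Type*} [Fintype α] [DecidableEq α]
    (c : ℤ × ℤ → α) (f : LaurentPoly₂ ℤ) : ℕ∞ :=
  vectorAbelianComplexity (vectorPresentation c) (LaurentPoly₂.scalarMatrixPoly α f)

/-- The set of patterns of shape `D` that appear in `c`. -/
def patterns {α : Type*} (c : ℤ × ℤ → α) (D : Finset (ℤ × ℤ)) : Set (D → α) :=
  Set.range fun t : ℤ × ℤ => fun u : D => translate t c u

/-- The number of occurrences of the color `a` in the pattern `p`. -/
noncomputable def occurrences {α : Type*} {D : Finset (ℤ × ℤ)} (p : D → α) (a : α) : ℕ :=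
  Nat.card {u : D // p u = a}

/-- Abelian equivalence of patterns of shape `D`. -/
def abelianSetoid (α : Type*) (D : Finset (ℤ × ℤ)) : Setoid (D → α) where
  r p q := ∀ a : α, occurrences p a = occurrences q a
  iseqv := ⟨fun _ _ => rfl, fun h a => (h a).symm, fun h₁ h₂ a => (h₁ a).trans (h₂ a)⟩

/-- The abelian complexity `A(c, D)` of a configuration with respect to a finite shape `D`: the
number of patterns of shape `D` in `c` up to abelian equivalence. -/
noncomputable def shapeAbelianComplexity {α : Type*} (c : ℤ × ℤ → α) (D : Finset (ℤ × ℤ)) : ℕ∞ :=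
  (Quotient.mk (abelianSetoid α D) '' patterns c D).encard

end Configuration₂

/-! Write `X` for the pair of variables. Coding symbols as integers turns complexity one into a
bounded integral `c` with `f c` constant, so `(X^v - 1) f` annihilates `c` for each `v`.

For a prime `p` exceeding a bound depending on `f` and `c`, the congruence `f^p ≡ f(X^p) mod p`
shows that an annihilator `f` gives another one, `f(X^p)`. A Vandermonde elimination among the
`f(X^(1 + i r))` then annihilates `c` by a product of binomials `X^u - 1`, `u ≠ 0`
(`exists_prod_single_sub_one_mem_annihilator`).

Modulo `f`, each binomial can be replaced by a nonzero polynomial in `X^v`. If `u` is parallel to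
`v`, a multiple of the binomial serves. Otherwise the binomial is a product of prime elements
`Φ_d(X^u')`, with `u'` primitive along `u`; none divides `f`, as it would be a line factor in a
direction other than `v`. The quotient by such a prime is a domain integral over the image of
`ℤ[X^(±v)]`, so the nonzero ideal generated by `f` contracts to a nonzero ideal
(`exists_lineHom_mem_span_pair_single_sub_one`).

Multiplying up, `c` has a nonzero annihilator in `X^v` alone. The binomial theorem applied to it
yields a power of `X^(N v) - 1` with `N ≠ 0`, and boundedness reduces the power to one. Convexity
plays no role. -/

namespace Configuration₂

open AddMonoidAlgebra

/-! ### Formal multiplication and the annihilator ideal -/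

/-- The action of Laurent polynomials on integral configurations by formal multiplication. -/
noncomputable def action : LaurentPoly₂ ℤ →ₐ[ℤ] Module.End ℤ (ℤ × ℤ → ℤ) :=
  AddMonoidAlgebra.lift ℤ (Module.End ℤ (ℤ × ℤ → ℤ)) (ℤ × ℤ)
    { toFun := fun t => LinearMap.funLeft ℤ ℤ fun u => u - t.toAdd
      map_one' := by ext; simp [LinearMap.funLeft]
      map_mul' := fun s t => by
        refine LinearMap.ext fun c => funext fun u => ?_
        simp [LinearMap.funLeft_apply, Module.End.mul_apply, sub_sub] }

theorem action_single (w : ℤ × ℤ) (a : ℤ) (c : ℤ × ℤ → ℤ) (u : ℤ × ℤ) :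
    action (single w a) c u = a * c (u - w) := by
  simp [action, LinearMap.funLeft_apply]

theorem action_eq_formalProduct (f : LaurentPoly₂ ℤ) (c : ℤ × ℤ → ℤ) :
    action f c = formalProduct f c := by
  funext u
  conv_lhs => rw [← sum_coeff_single f, Finsupp.sum]
  rw [map_sum]
  simp [LinearMap.sum_apply, Finset.sum_apply, action_single, formalProduct]

/-- The ideal of Laurent polynomials annihilating an integral configuration. -/
noncomputable def annihilator (c : ℤ × ℤ → ℤ) : Ideal (LaurentPoly₂ ℤ) where
  carrier := {f | action f c = 0}
  add_mem' := fun {f g} hf hg => by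
    simp only [Set.mem_ofPred_eq] at *
    rw [map_add, LinearMap.add_apply, hf, hg, add_zero]
  zero_mem' := by simp
  smul_mem' := fun g f hf => by
    simp only [Set.mem_ofPred_eq, smul_eq_mul] at *
    rw [map_mul, Module.End.mul_apply, hf, map_zero]

theorem mem_annihilator {c : ℤ × ℤ → ℤ} {f : LaurentPoly₂ ℤ} :
    f ∈ annihilator c ↔ action f c = 0 := Iff.rfl

theorem single_sub_one_mem_annihilator {c : ℤ × ℤ → ℤ} {t : ℤ × ℤ} :
    single t 1 - 1 ∈ annihilator c ↔ HasPeriod c t := by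
  rw [mem_annihilator, map_sub, map_one, LinearMap.sub_apply, sub_eq_zero]
  have : action (single t 1) c = translate t c := by
    funext u; simp [action_single, translate]
  rw [this]; rfl

/-! ### Expanded annihilators and products of binomials -/

/-- The substitution `f(X) ↦ f(X ^ n)`. -/
noncomputable def expand (n : ℕ) : LaurentPoly₂ ℤ →+* LaurentPoly₂ ℤ :=
  mapDomainRingHom ℤ (nsmulAddMonoidHom (α := ℤ × ℤ) n)

theorem expand_single (n : ℕ) (w : ℤ × ℤ) (a : ℤ) :
    expand n (single w a) = single (n • w) a := by
  simp [expand]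

theorem expand_one (f : LaurentPoly₂ ℤ) : expand 1 f = f := by
  have : expand 1 = RingHom.id _ := by ext <;> simp [expand]
  rw [this]; rfl

theorem expand_mul (m n : ℕ) (f : LaurentPoly₂ ℤ) : expand (m * n) f = expand m (expand n f) := by
  induction f using AddMonoidAlgebra.induction_linear with
  | zero => simp
  | add f g hf hg => simp [hf, hg]
  | single w a => simp [expand_single, mul_smul]

theorem expand_eq_sum (n : ℕ) (f : LaurentPoly₂ ℤ) :
    expand n f = ∑ w ∈ f.coeff.support, single (n • w) (f.coeff w) := by
  conv_lhs => rw [← sum_coeff_single f, Finsupp.sum]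
  rw [map_sum]
  simp [expand_single]

theorem exists_pow_prime_eq_expand_add {p : ℕ} (hp : p.Prime) (f : LaurentPoly₂ ℤ) :
    ∃ g : LaurentPoly₂ ℤ, f ^ p = expand p f + (p : LaurentPoly₂ ℤ) * g := by
  induction f using AddMonoidAlgebra.induction_linear with
  | zero => exact ⟨0, by simp [hp.ne_zero]⟩
  | add f g hf hg =>
    obtain ⟨a, ha⟩ := hf
    obtain ⟨b, hb⟩ := hg
    obtain ⟨r, hr⟩ := exists_add_pow_prime_eq hp f g
    refine ⟨a + b + f * g * r, ?_⟩
    rw [hr, ha, hb, map_add]; ring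
  | single w a =>
    have : Fact p.Prime := ⟨hp⟩
    have h : (p : ℤ) ∣ a ^ p - a := by
      rw [← ZMod.intCast_zmod_eq_zero_iff_dvd]
      simp
    obtain ⟨k, hk⟩ := h
    refine ⟨single (p • w) k, ?_⟩
    rw [single_pow, expand_single, AddMonoidAlgebra.natCast_def, single_mul_single, zero_add,
      ← single_add]
    congr 1
    linarith

/-- The values of `f(X^(p n)) c` are divisible by `p`, since `f(X^(p n)) ≡ f(X^n)^p mod p`, and
smaller than `p` in absolute value. The bound involves `f` rather than `expand n f`, so it does not
deteriorate under iteration. -/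
theorem expand_mem_annihilator_of_prime {c : ℤ × ℤ → ℤ} {M : ℤ} (hM : ∀ u, |c u| ≤ M)
    {f : LaurentPoly₂ ℤ} {n p : ℕ} (hf : expand n f ∈ annihilator c) (hp : p.Prime)
    (hlt : (∑ w ∈ f.coeff.support, |f.coeff w|) * M < p) :
    expand (p * n) f ∈ annihilator c := by
  obtain ⟨g, hg⟩ := exists_pow_prime_eq_expand_add hp (expand n f)
  rw [← expand_mul] at hg
  have hpow : expand n f ^ p ∈ annihilator c := Ideal.pow_mem_of_mem _ hf _ hp.pos
  have key : action (expand (p * n) f) c = -((p : ℤ) • action g c) := by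
    rw [hg, mem_annihilator, map_add, map_mul, map_natCast, LinearMap.add_apply,
      Module.End.mul_apply] at hpow
    rw [eq_neg_iff_add_eq_zero, ← hpow]
    simp
  rw [mem_annihilator]
  funext u
  refine Int.eq_zero_of_abs_lt_dvd (m := p) ⟨-(action g c u), ?_⟩ (lt_of_le_of_lt ?_ hlt)
  · rw [key]; simp
  · rw [expand_eq_sum, map_sum, LinearMap.sum_apply, Finset.sum_apply, Finset.sum_mul]
    refine (Finset.abs_sum_le_sum_abs _ _).trans (Finset.sum_le_sum fun w _ => ?_)
    rw [action_single, abs_mul]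
    exact mul_le_mul_of_nonneg_left (hM _) (abs_nonneg _)

theorem expand_mem_annihilator {c : ℤ × ℤ → ℤ} {M : ℤ} (hM : ∀ u, |c u| ≤ M)
    {f : LaurentPoly₂ ℤ} (hf : f ∈ annihilator c) {n : ℕ} (hn : n ≠ 0)
    (hlt : ∀ p : ℕ, p.Prime → p ∣ n → (∑ w ∈ f.coeff.support, |f.coeff w|) * M < p) :
    expand n f ∈ annihilator c := by
  induction n using induction_on_primes with
  | zero => exact absurd rfl hn
  | one => rwa [expand_one]
  | prime_mul p n hp ih =>
    refine expand_mem_annihilator_of_prime hM (ih (right_ne_zero_of_mul hn) fun q hq hqn =>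
      hlt q hq (hqn.mul_left p)) hp (hlt p hp (dvd_mul_right p n))

theorem exists_forall_expand_mem_annihilator {c : ℤ × ℤ → ℤ} {M : ℤ} (hM : ∀ u, |c u| ≤ M)
    {f : LaurentPoly₂ ℤ} (hf : f ∈ annihilator c) :
    ∃ r : ℕ, r ≠ 0 ∧ ∀ i : ℕ, expand (1 + i * r) f ∈ annihilator c := by
  set L := ((∑ w ∈ f.coeff.support, |f.coeff w|) * M).toNat
  -- No prime up to `L` divides `1 + i * L!`.
  refine ⟨L.factorial, L.factorial_ne_zero, fun i => expand_mem_annihilator hM hf (by omega) ?_⟩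
  intro p hp hdvd
  have : L < p := by
    by_contra! h
    have h1 : p ∣ i * L.factorial := ((hp.dvd_factorial).2 h).mul_left i
    exact hp.one_lt.ne' (Nat.dvd_one.1 ((Nat.dvd_add_left h1).1 hdvd))
  have := Int.self_le_toNat ((∑ w ∈ f.coeff.support, |f.coeff w|) * M)
  omega

/-- Vandermonde elimination: `P` vanishes at `X^(r w)` for every `w ≠ v` in the support, so
weighting the `f(X^(1 + i r))` by the coefficients of `P` leaves only the term of `v`. Its monomial
is a unit, and its integer coefficient cancels because `ℤ` has no torsion. -/
theorem prod_single_sub_single_mem_annihilator {c : ℤ × ℤ → ℤ} {f : LaurentPoly₂ ℤ} {r : ℕ}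
    (hf : ∀ i : ℕ, expand (1 + i * r) f ∈ annihilator c) {v : ℤ × ℤ}
    (hv : v ∈ f.coeff.support) :
    ∏ w ∈ f.coeff.support.erase v, (single (r • v) 1 - single (r • w) 1) ∈ annihilator c := by
  set P : Polynomial (LaurentPoly₂ ℤ) :=
    ∏ w ∈ f.coeff.support.erase v, (Polynomial.X - Polynomial.C (single (r • w) 1)) with hP
  have heval : ∀ x, P.eval x = ∏ w ∈ f.coeff.support.erase v, (x - single (r • w) 1) := by
    intro x; simp [hP, Polynomial.eval_prod]
  have hsum : ∑ i ∈ Finset.range (P.natDegree + 1), P.coeff i * expand (1 + i * r) f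
      = single v (f.coeff v) * P.eval (single (r • v) 1) := by
    calc _ = ∑ w ∈ f.coeff.support, single w (f.coeff w) * P.eval (single (r • w) 1) := by
          simp_rw [expand_eq_sum, Finset.mul_sum, Polynomial.eval_eq_sum_range, Finset.mul_sum]
          rw [Finset.sum_comm]
          refine Finset.sum_congr rfl fun w _ => Finset.sum_congr rfl fun i _ => ?_
          rw [single_pow, mul_left_comm, single_mul_single]
          simp [add_smul, mul_smul]
      _ = _ := by
          refine Finset.sum_eq_single_of_mem v hv fun w hw hne => ?_
          have h0 : ∏ w' ∈ f.coeff.support.erase v,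
              (single (r • w) 1 - single (r • w') 1 : LaurentPoly₂ ℤ) = 0 :=
            Finset.prod_eq_zero (Finset.mem_erase.2 ⟨hne, hw⟩) (sub_self _)
          rw [heval, h0, mul_zero]
  have hmem : single v (f.coeff v) * P.eval (single (r • v) 1) ∈ annihilator c := by
    rw [← hsum]
    exact Ideal.sum_mem _ fun i _ => Ideal.mul_mem_left _ _ (hf i)
  rw [← heval]
  have h2 := Ideal.mul_mem_left _ (single (-v) 1) hmem
  rw [← mul_assoc, single_mul_single, neg_add_cancel, one_mul, mem_annihilator, map_mul,
    Module.End.mul_apply] at h2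
  rw [mem_annihilator]
  funext u
  have h3 := congrFun h2 u
  rw [action_single, sub_zero] at h3
  exact (mul_eq_zero.1 h3).resolve_left (Finsupp.mem_support_iff.1 hv)

theorem exists_prod_single_sub_one_mem_annihilator {c : ℤ × ℤ → ℤ} {M : ℤ}
    (hM : ∀ u, |c u| ≤ M) {f : LaurentPoly₂ ℤ} (hf : f ∈ annihilator c) (hf0 : f ≠ 0) :
    ∃ r : ℕ, r ≠ 0 ∧ ∃ v ∈ f.coeff.support,
      ∏ w ∈ f.coeff.support.erase v, (single (r • (w - v)) 1 - 1) ∈ annihilator c := by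
  obtain ⟨r, hr, h⟩ := exists_forall_expand_mem_annihilator hM hf
  obtain ⟨v, hv⟩ : f.coeff.support.Nonempty := by
    rw [Finsupp.support_nonempty_iff]; simpa using hf0
  refine ⟨r, hr, v, hv, ?_⟩
  have h1 := prod_single_sub_single_mem_annihilator h hv
  -- Multiplying each factor by the unit `-X^(-r v)` turns differences of monomials into binomials.
  have h2 := Ideal.mul_mem_left _
    (∏ w ∈ f.coeff.support.erase v, (-single (-(r • v)) 1 : LaurentPoly₂ ℤ)) h1
  rw [← Finset.prod_mul_distrib] at h2
  convert h2 using 1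
  refine Finset.prod_congr rfl fun w _ => ?_
  rw [mul_sub, neg_mul, neg_mul, single_mul_single, single_mul_single, neg_add_cancel, smul_sub,
    one_def, mul_one, sub_eq_add_neg (r • w), add_comm (r • w)]
  abel

end Configuration₂

/-! ### Cyclotomic line polynomials and elimination modulo `f` -/

namespace LaurentPoly₂

open AddMonoidAlgebra

/-- The substitution `T ↦ X ^ v` of univariate into bivariate Laurent polynomials. -/
noncomputable def lineHom (v : ℤ × ℤ) : LaurentPolynomial ℤ →+* LaurentPoly₂ ℤ :=
  mapDomainRingHom ℤ (zmultiplesHom (ℤ × ℤ) v)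

theorem lineHom_single (v : ℤ × ℤ) (n a : ℤ) : lineHom v (single n a) = single (n • v) a :=
  mapDomain_single

theorem lineHom_injective {v : ℤ × ℤ} (hv : v ≠ 0) : Function.Injective (lineHom v) := by
  refine mapDomain_injective fun m n h => ?_
  exact smul_left_injective ℤ hv (by simpa using h)

theorem exists_smul_of_mem_support_lineHom {v w : ℤ × ℤ} {g : LaurentPolynomial ℤ}
    (hw : w ∈ (lineHom v g).coeff.support) : ∃ n : ℤ, w = n • v := by
  classical
  have := Finsupp.mapDomain_support (f := zmultiplesHom (ℤ × ℤ) v) (s := g.coeff) hw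
  obtain ⟨n, _, hn⟩ := Finset.mem_image.1 this
  exact ⟨n, by simpa using hn.symm⟩

/-- The automorphism of `ℤ × ℤ` giving the coordinates `(β, α)` of `w = α u + β (-b, a)`,
where `a * u.1 + b * u.2 = 1`. -/
def unimodularEquiv (u : ℤ × ℤ) (a b : ℤ) (h : a * u.1 + b * u.2 = 1) : ℤ × ℤ ≃+ ℤ × ℤ where
  toFun w := (u.1 * w.2 - u.2 * w.1, a * w.1 + b * w.2)
  invFun w := (w.2 * u.1 - w.1 * b, w.2 * u.2 + w.1 * a)
  left_inv w := by
    ext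
    · linear_combination w.1 * h
    · linear_combination w.2 * h
  right_inv w := by
    ext
    · linear_combination w.1 * h
    · linear_combination w.2 * h
  map_add' w w' := by ext <;> simp <;> ring

theorem single_zero_dvd_iff {A G : Type*} [CommRing A] [AddCommGroup G] {p : A}
    {F : AddMonoidAlgebra A G} : single 0 p ∣ F ↔ ∀ j, p ∣ F.coeff j := by
  constructor
  · rintro ⟨F, rfl⟩ j
    rw [coeff_single_zero_mul]
    exact dvd_mul_right _ _
  · intro h
    rw [← sum_coeff_single F]
    refine Finset.dvd_sum fun j _ => ?_
    obtain ⟨k, hk⟩ := h j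
    exact ⟨single j k, by rw [single_mul_single, zero_add, hk]⟩

theorem toLaurent_cyclotomic_dvd_of_eval₂_eq_zero {d : ℕ} (hd : 0 < d) {ζ : ℂˣ}
    (hζ : IsPrimitiveRoot (ζ : ℂ) d) {g : LaurentPolynomial ℤ}
    (hg : LaurentPolynomial.eval₂ (Int.castRingHom ℂ) ζ g = 0) :
    Polynomial.toLaurent (Polynomial.cyclotomic d ℤ) ∣ g := by
  obtain ⟨n, g', hg'⟩ := g.exists_T_pow
  have h0 : Polynomial.aeval (ζ : ℂ) g' = 0 := by
    rw [Polynomial.aeval_def, algebraMap_int_eq, ← LaurentPolynomial.eval₂_toLaurent, hg', map_mul,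
      hg, zero_mul]
  have hdvd : Polynomial.cyclotomic d ℤ ∣ g' := by
    rw [Polynomial.cyclotomic_eq_minpoly hζ hd]
    exact minpoly.isIntegrallyClosed_dvd (hζ.isIntegral hd) h0
  have h1 := map_dvd Polynomial.toLaurent hdvd
  rw [hg'] at h1
  have h2 := h1.mul_right (LaurentPolynomial.T (-(n : ℤ)))
  rwa [mul_assoc, ← LaurentPolynomial.T_add, add_neg_cancel, LaurentPolynomial.T_zero,
    mul_one] at h2

/-- In unimodular coordinates `X^u` is one of the two variables; the map evaluates it at a primitive
`d`-th root of unity. Its kernel is described coefficientwise by the minimal polynomial of the root.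
The target being a domain, `Φ_d(X^u)` generates a prime ideal. -/
theorem exists_ringHom_ker_eq_span_cyclotomic {u : ℤ × ℤ} (hu : IsPrimitiveVector u) {d : ℕ}
    (hd : 0 < d) : ∃ φ : LaurentPoly₂ ℤ →+* LaurentPolynomial ℂ, RingHom.ker φ =
      Ideal.span {lineHom u (Polynomial.toLaurent (Polynomial.cyclotomic d ℤ))} := by
  obtain ⟨a, b, hab⟩ := hu
  have hζ := Complex.isPrimitiveRoot_exp d hd.ne'
  obtain ⟨ζ, hζu⟩ := hζ.isUnit hd.ne'
  rw [← hζu] at hζ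
  set ev : LaurentPolynomial ℤ →+* ℂ := LaurentPolynomial.eval₂ (Int.castRingHom ℂ) ζ
  set E : LaurentPoly₂ ℤ ≃+* AddMonoidAlgebra (LaurentPolynomial ℤ) ℤ :=
    (mapDomainRingEquiv ℤ (unimodularEquiv u a b hab)).trans curryRingEquiv
  have hE : ∀ g, E (lineHom u g) = single 0 g := by
    intro g
    induction g using AddMonoidAlgebra.induction_linear with
    | zero => simp
    | add f g hf hg => simp [hf, hg, single_add]
    | single n m =>
      have : unimodularEquiv u a b hab (n • u) = (0, n) := by
        ext
        · simp [unimodularEquiv]; ring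
        · simp [unimodularEquiv]; linear_combination n * hab
      rw [lineHom_single, RingEquiv.trans_apply, mapDomainRingEquiv_single, this,
        curryRingEquiv_single]
  refine ⟨(mapRingHom ℤ ev).comp E.toRingHom, ?_⟩
  ext f
  rw [Ideal.mem_span_singleton, RingHom.mem_ker, ← map_dvd_iff E, hE, single_zero_dvd_iff]
  have hcyc : ev (Polynomial.toLaurent (Polynomial.cyclotomic d ℤ)) = 0 := by
    rw [LaurentPolynomial.eval₂_toLaurent, ← Polynomial.eval_map, Polynomial.map_cyclotomic]
    exact hζ.isRoot_cyclotomic hd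
  constructor
  · intro h j
    refine toLaurent_cyclotomic_dvd_of_eval₂_eq_zero hd hζ ?_
    have := DFunLike.congr_fun (congrArg coeff h) j
    simpa using this
  · intro h
    ext j
    obtain ⟨k, hk⟩ := h j
    have : ev ((E f).coeff j) = 0 := by rw [hk, map_mul, hcyc, zero_mul]
    simpa using this

/-- The determinant of a pair of vectors. -/
def det₂ (u v : ℤ × ℤ) : ℤ := u.1 * v.2 - u.2 * v.1

/-- Modulo `P` we have `X^u = 1`, so some power of each monomial is a power of `X^v` and the
quotient is integral over `ℤ[X^(±v)]`. In an integral domain extension a nonzero ideal has nonzero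
contraction. -/
theorem exists_lineHom_mem_sup_of_isPrime {P : Ideal (LaurentPoly₂ ℤ)} [P.IsPrime] {u v : ℤ × ℤ}
    (huv : det₂ u v ≠ 0) (hu : single u 1 - 1 ∈ P) {f : LaurentPoly₂ ℤ} (hf : f ∉ P) :
    ∃ a : LaurentPolynomial ℤ, a ≠ 0 ∧ lineHom v a ∈ Ideal.span {f} ⊔ P := by
  let π := Ideal.Quotient.mk P
  let _ : Algebra (LaurentPolynomial ℤ) (LaurentPoly₂ ℤ ⧸ P) := (π.comp (lineHom v)).toAlgebra
  have halg : ∀ a, algebraMap (LaurentPolynomial ℤ) (LaurentPoly₂ ℤ ⧸ P) a = π (lineHom v a) :=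
    fun _ => rfl
  have hu1 : π (single u 1) = 1 := by
    rw [← map_one π]; exact Ideal.Quotient.eq.2 hu
  have hun : ∀ n : ℤ, π (single (n • u) 1) = 1 := by
    intro n
    induction n using Int.induction_on with
    | zero => rw [zero_smul, ← one_def, map_one]
    | succ n ih =>
      have : (single (((n : ℤ) + 1) • u) 1 : LaurentPoly₂ ℤ)
          = single ((n : ℤ) • u) 1 * single u 1 := by
        rw [single_mul_single, add_smul, one_smul, one_mul]
      rw [this, map_mul, ih, hu1, one_mul]
    | pred n ih =>
      have : (single ((-(n : ℤ)) • u) 1 : LaurentPoly₂ ℤ)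
          = single ((-(n : ℤ) - 1) • u) 1 * single u 1 := by
        rw [single_mul_single, sub_smul, one_smul, one_mul, sub_add_cancel]
      rw [this, map_mul, hu1, mul_one] at ih
      exact ih
  have hint : ∀ x : LaurentPoly₂ ℤ, IsIntegral (LaurentPolynomial ℤ) (π x) := by
    intro x
    induction x using AddMonoidAlgebra.induction_linear with
    | zero => rw [map_zero]; exact isIntegral_zero
    | add f g hf hg => rw [map_add]; exact hf.add hg
    | single w m =>
      have h1 : (single w m : LaurentPoly₂ ℤ) = single w 1 * lineHom v (single 0 m) := by
        rw [lineHom_single, single_mul_single]; simp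
      rw [h1, map_mul, ← halg]
      refine IsIntegral.mul ?_ isIntegral_algebraMap
      have hpos : 0 < (det₂ u v).natAbs ^ 2 := pow_pos (Int.natAbs_pos.2 huv) 2
      refine IsIntegral.of_pow hpos ?_
      -- Cramer's rule, multiplied once more by the determinant to make the exponent a positive
      -- natural number.
      have h2 : ((det₂ u v).natAbs ^ 2) • w
          = (det₂ u v * det₂ w v) • u + (det₂ u v * det₂ u w) • v := by
        have h3 : (((det₂ u v).natAbs ^ 2 : ℕ) : ℤ) = det₂ u v ^ 2 := by
          push_cast; exact sq_abs _
        rw [← natCast_zsmul, h3]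
        ext <;> simp [det₂] <;> ring
      rw [← map_pow, single_pow, one_pow, h2]
      have h4 : (single ((det₂ u v * det₂ w v) • u + (det₂ u v * det₂ u w) • v) 1 : LaurentPoly₂ ℤ)
          = single ((det₂ u v * det₂ w v) • u) 1 * lineHom v (single (det₂ u v * det₂ u w) 1) := by
        rw [lineHom_single, single_mul_single, one_mul]
      rw [h4, map_mul, hun, one_mul, ← halg]
      exact isIntegral_algebraMap
  have hne : π f ≠ 0 := fun h => hf (Ideal.Quotient.eq_zero_iff_mem.1 h)
  have hbot := Ideal.comap_ne_bot_of_integral_mem hne (Ideal.mem_span_singleton_self (π f)) (hint f)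
  obtain ⟨a, ha, ha0⟩ := Submodule.exists_mem_ne_zero_of_ne_bot hbot
  refine ⟨a, ha0, ?_⟩
  rw [Ideal.mem_comap, halg, ← Set.image_singleton, ← Ideal.map_span,
    Ideal.mem_quotient_iff_mem_sup] at ha
  exact ha

theorem det₂_eq_zero_of_lineDirections {f : LaurentPoly₂ ℤ} {u v : ℤ × ℤ}
    (hf : f.IsLinePolynomialInDirection u) (hf' : f.IsLinePolynomialInDirection v) :
    det₂ u v = 0 := by
  obtain ⟨hcard, x, hx⟩ := hf
  obtain ⟨-, y, hy⟩ := hf'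
  obtain ⟨p, hp, q, hq, hpq⟩ := Finset.one_lt_card.1 hcard
  obtain ⟨a, ha1, ha2⟩ := hx p hp
  obtain ⟨b, hb1, hb2⟩ := hx q hq
  obtain ⟨a', ha1', ha2'⟩ := hy p hp
  obtain ⟨b', hb1', hb2'⟩ := hy q hq
  by_contra hdet
  have hdet' : (u.1 * v.2 - u.2 * v.1 : ℚ) ≠ 0 := by exact_mod_cast hdet
  have hab : a - b = 0 := by
    refine (mul_eq_zero.1 ?_).resolve_right hdet'
    linear_combination v.2 * (ha1' - hb1' - ha1 + hb1) - v.1 * (ha2' - hb2' - ha2 + hb2)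
  apply hpq
  have hab : a = b := by linarith
  subst hab
  ext
  · have : (p.1 : ℚ) = q.1 := by rw [ha1, hb1]
    exact_mod_cast this
  · have : (p.2 : ℚ) = q.2 := by rw [ha2, hb2]
    exact_mod_cast this

theorem isLinePolynomialInDirection_lineHom_cyclotomic {u : ℤ × ℤ} (hu : IsPrimitiveVector u)
    {d : ℕ} (hd : 0 < d) :
    (lineHom u (Polynomial.toLaurent (Polynomial.cyclotomic d ℤ))).IsLinePolynomialInDirection
      u := by
  set q := lineHom u (Polynomial.toLaurent (Polynomial.cyclotomic d ℤ)) with hq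
  have hu0 : u ≠ 0 := by
    rintro rfl
    exact not_isCoprime_zero_zero hu
  constructor
  -- A single term `m X^w` goes to `m` times a unit under the evaluation map, which would force `m =
  -- 0`.
  · by_contra! hcard
    obtain ⟨w, m, hwm⟩ := Finsupp.card_support_le_one'.1 (Nat.lt_succ_iff.1 hcard)
    have hq' : q = single w 1 * (m : LaurentPoly₂ ℤ) := by
      rw [intCast_def, single_mul_single, add_zero, one_mul]
      exact coeff_injective hwm
    obtain ⟨φ, hφ⟩ := exists_ringHom_ker_eq_span_cyclotomic hu hd
    have hqφ : φ q = 0 := by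
      rw [← RingHom.mem_ker, hφ]
      exact Ideal.mem_span_singleton_self q
    have hunit : IsUnit (single w 1 : LaurentPoly₂ ℤ) :=
      IsUnit.of_mul_eq_one (single (-w) 1) (by rw [single_mul_single, add_neg_cancel, mul_one]; rfl)
    rw [hq', map_mul, (hunit.map φ).mul_right_eq_zero, map_intCast] at hqφ
    have hm : m = 0 := by
      have : (algebraMap ℂ (LaurentPolynomial ℂ)) (m : ℂ) = 0 := by rw [map_intCast]; exact hqφ
      exact_mod_cast (map_eq_zero_iff _ (algebraMap ℂ (LaurentPolynomial ℂ)).injective).1 this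
    rw [hm, Int.cast_zero, mul_zero] at hq'
    have h0 := (map_eq_zero_iff _ (lineHom_injective hu0)).1 hq'
    exact Polynomial.cyclotomic_ne_zero d ℤ
      ((map_eq_zero_iff _ Polynomial.toLaurent_injective).1 h0)
  · refine ⟨0, fun w hw => ?_⟩
    obtain ⟨n, rfl⟩ := exists_smul_of_mem_support_lineHom hw
    exact ⟨n, by simp⟩

theorem exists_lineHom_mem_span_pair_cyclotomic {f : LaurentPoly₂ ℤ} {u v : ℤ × ℤ}
    (hu : IsPrimitiveVector u) (huv : det₂ u v ≠ 0) (hf : f.AllLineFactorsInDirection v) {d : ℕ}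
    (hd : 0 < d) : ∃ a : LaurentPolynomial ℤ, a ≠ 0 ∧ lineHom v a ∈
      Ideal.span {f, lineHom u (Polynomial.toLaurent (Polynomial.cyclotomic d ℤ))} := by
  set q := lineHom u (Polynomial.toLaurent (Polynomial.cyclotomic d ℤ))
  obtain ⟨φ, hφ⟩ := exists_ringHom_ker_eq_span_cyclotomic hu hd
  have hprime : (Ideal.span {q}).IsPrime := hφ ▸ RingHom.ker_isPrime φ
  have hline := isLinePolynomialInDirection_lineHom_cyclotomic hu hd
  have hfq : f ∉ Ideal.span {q} := fun h => huv <|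
    det₂_eq_zero_of_lineDirections hline (hf q (Ideal.mem_span_singleton.1 h) ⟨u, hline⟩)
  have hmem : single (d • u) 1 - 1 ∈ Ideal.span {q} := by
    rw [Ideal.mem_span_singleton]
    have h1 := map_dvd (lineHom u) (map_dvd Polynomial.toLaurent
      (Polynomial.cyclotomic.dvd_X_pow_sub_one d ℤ))
    rw [map_sub, Polynomial.toLaurent_X_pow, map_sub, map_one, map_one, LaurentPolynomial.T,
      lineHom_single, natCast_zsmul] at h1
    exact h1
  have hdet : det₂ (d • u) v ≠ 0 := by
    have : det₂ (d • u) v = d * det₂ u v := by simp [det₂]; ring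
    rw [this]
    exact mul_ne_zero (by exact_mod_cast hd.ne') huv
  obtain ⟨a, ha0, ha⟩ := exists_lineHom_mem_sup_of_isPrime hdet hmem hfq
  exact ⟨a, ha0, by rwa [Ideal.span_insert]⟩

/-- The product of the ideals `(f, g)` and `(f, h)` lies in `(f, g h)`. -/
theorem exists_lineHom_mem_span_pair_prod {ι : Type*} {f : LaurentPoly₂ ℤ} {v : ℤ × ℤ}
    (s : Finset ι) (g : ι → LaurentPoly₂ ℤ)
    (h : ∀ i ∈ s, ∃ a : LaurentPolynomial ℤ, a ≠ 0 ∧ lineHom v a ∈ Ideal.span {f, g i}) :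
    ∃ a : LaurentPolynomial ℤ, a ≠ 0 ∧ lineHom v a ∈ Ideal.span {f, ∏ i ∈ s, g i} := by
  classical
  induction s using Finset.induction_on with
  | empty =>
    exact ⟨1, one_ne_zero, by
      rw [map_one, Finset.prod_empty]; exact Ideal.subset_span (by simp)⟩
  | insert i s hi ih =>
    obtain ⟨a, ha0, ha⟩ := h i (Finset.mem_insert_self i s)
    obtain ⟨b, hb0, hb⟩ := ih fun j hj => h j (Finset.mem_insert_of_mem hj)
    refine ⟨a * b, mul_ne_zero ha0 hb0, ?_⟩
    rw [map_mul, Finset.prod_insert hi]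
    obtain ⟨x, y, hxy⟩ := Ideal.mem_span_pair.1 ha
    obtain ⟨x', y', hxy'⟩ := Ideal.mem_span_pair.1 hb
    rw [Ideal.mem_span_pair]
    refine ⟨x * x' * f + x * y' * (∏ j ∈ s, g j) + y * x' * g i, y * y', ?_⟩
    rw [← hxy, ← hxy']; ring

theorem exists_lineHom_mem_span_pair_single_sub_one {f : LaurentPoly₂ ℤ} {u v : ℤ × ℤ}
    (hu : u ≠ 0) (hv : v ≠ 0) (hf : f.AllLineFactorsInDirection v) :
    ∃ a : LaurentPolynomial ℤ, a ≠ 0 ∧ lineHom v a ∈ Ideal.span {f, single u 1 - 1} := by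
  by_cases huv : det₂ u v = 0
  -- Parallel case: `X^(k u) - 1 = X^(l v) - 1` is already a multiple of `X^u - 1`. Squares in the
  -- witnesses keep `k` natural.
  · obtain ⟨k, l, hl, hkl⟩ : ∃ (k : ℕ) (l : ℤ), l ≠ 0 ∧ k • u = l • v := by
      rw [det₂, sub_eq_zero] at huv
      by_cases h1 : v.1 = 0
      · have h2 : v.2 ≠ 0 := fun h2 => hv (Prod.ext h1 h2)
        have hu1 : u.1 = 0 := by simpa [h1, h2] using huv
        refine ⟨v.2.natAbs ^ 2, v.2 * u.2, mul_ne_zero h2 fun hu2 => hu (Prod.ext hu1 hu2), ?_⟩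
        rw [← natCast_zsmul, Nat.cast_pow, Int.natAbs_sq]
        ext
        · simp [h1, hu1]
        · simp; ring
      · refine ⟨v.1.natAbs ^ 2, v.1 * u.1, mul_ne_zero h1 fun hu1 => hu (Prod.ext hu1 ?_), ?_⟩
        · simpa [hu1, h1] using huv.symm
        · rw [← natCast_zsmul, Nat.cast_pow, Int.natAbs_sq]
          ext
          · simp; ring
          · simp; linear_combination -v.1 * huv
    refine ⟨single l 1 - 1, ?_, ?_⟩
    · rw [sub_ne_zero, one_def, Ne, single_left_inj one_ne_zero]
      exact hl
    · rw [map_sub, map_one, lineHom_single, ← hkl, ← one_pow k, ← single_pow, one_pow]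
      exact Ideal.mem_of_dvd _ (sub_one_dvd_pow_sub_one _ k) (Ideal.subset_span (by simp))
  · obtain ⟨u', k, hu', hk, rfl⟩ : ∃ (u' : ℤ × ℤ) (k : ℕ), IsPrimitiveVector u' ∧ 0 < k ∧
        u = k • u' := by
      have hpos : 0 < Int.gcd u.1 u.2 := Nat.pos_of_ne_zero fun h =>
        hu (Prod.ext (Int.gcd_eq_zero_iff.1 h).1 (Int.gcd_eq_zero_iff.1 h).2)
      obtain ⟨m, n, hmn, h1, h2⟩ := Int.exists_gcd_one hpos
      refine ⟨(m, n), Int.gcd u.1 u.2, Int.isCoprime_iff_gcd_eq_one.2 hmn, hpos, ?_⟩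
      ext
      · simpa [mul_comm] using h1
      · simpa [mul_comm] using h2
    have huv' : det₂ u' v ≠ 0 := by
      intro h
      apply huv
      have : det₂ (k • u') v = k * det₂ u' v := by simp [det₂]; ring
      rw [this, h, mul_zero]
    have hprod : (single (k • u') 1 - 1 : LaurentPoly₂ ℤ) = ∏ d ∈ k.divisors,
        lineHom u' (Polynomial.toLaurent (Polynomial.cyclotomic d ℤ)) := by
      rw [← map_prod, ← map_prod, Polynomial.prod_cyclotomic_eq_X_pow_sub_one hk, map_sub,
        Polynomial.toLaurent_X_pow, map_sub, map_one, map_one, LaurentPolynomial.T,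
        lineHom_single, natCast_zsmul]
    rw [hprod]
    exact exists_lineHom_mem_span_pair_prod _ _ fun d hd =>
      exists_lineHom_mem_span_pair_cyclotomic hu' huv' hf (Nat.pos_of_mem_divisors hd)

end LaurentPoly₂

/-! ### From annihilators to periods of bounded configurations -/

namespace Configuration₂

open AddMonoidAlgebra LaurentPoly₂

/-- Along `t` the values form an arithmetic progression, and a bounded one is constant. -/
theorem hasPeriod_of_sq_mem_annihilator {c : ℤ × ℤ → ℤ} {M : ℤ} (hM : ∀ u, |c u| ≤ M) {t : ℤ × ℤ}
    (h : (single t 1 - 1) ^ 2 ∈ annihilator c) : single t 1 - 1 ∈ annihilator c := by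
  have hd : ∀ u, c (u - t - t) - c (u - t) = c (u - t) - c u := by
    intro u
    have h1 := congrFun (mem_annihilator.1 h) u
    rw [sub_sq, one_pow, mul_one, single_pow, one_pow, map_add, map_sub, map_one, two_mul,
      map_add] at h1
    simp only [LinearMap.add_apply, LinearMap.sub_apply, Pi.add_apply, Pi.sub_apply,
      action_single, Module.End.one_apply, Pi.zero_apply, two_nsmul, ← sub_sub] at h1
    linarith
  -- The recurrence has order two, so the induction carries consecutive terms.
  have hn : ∀ u (n : ℕ), c (u - n • t) = c u + n * (c (u - t) - c u) ∧
      c (u - (n + 1) • t) = c u + (n + 1) * (c (u - t) - c u) := by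
    intro u n
    induction n with
    | zero => simp
    | succ n ih =>
      refine ⟨by push_cast; exact ih.2, ?_⟩
      have := hd (u - n • t)
      have e1 : u - n • t - t = u - (n + 1) • t := by rw [add_smul, one_smul]; abel
      have e2 : u - (n + 1) • t - t = u - (n + 1 + 1) • t := by
        rw [add_smul (n + 1), one_smul]; abel
      rw [e1, e2, ih.1, ih.2] at this
      push_cast
      linarith
  rw [single_sub_one_mem_annihilator]
  funext u
  change c (u - t) = c u
  by_contra hne
  have h1 : 1 ≤ |c (u - t) - c u| := Int.one_le_abs (sub_ne_zero.2 hne)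
  have hM0 : 0 ≤ M := (abs_nonneg _).trans (hM 0)
  set n : ℕ := (2 * M + 1).toNat
  have hn' : (n : ℤ) = 2 * M + 1 := Int.toNat_of_nonneg (by omega)
  have h2 : c (u - n • t) - c u = n * (c (u - t) - c u) := by rw [(hn u n).1]; ring
  have h3 : |c (u - n • t) - c u| ≤ 2 * M :=
    (abs_sub _ _).trans (by linarith [hM (u - n • t), hM u])
  rw [h2, abs_mul, Nat.abs_cast, hn'] at h3
  nlinarith

theorem abs_action_le {c : ℤ × ℤ → ℤ} {M : ℤ} (hM : ∀ u, |c u| ≤ M) (f : LaurentPoly₂ ℤ)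
    (u : ℤ × ℤ) : |action f c u| ≤ (∑ w ∈ f.coeff.support, |f.coeff w|) * M := by
  rw [action_eq_formalProduct, formalProduct, Finset.sum_mul]
  refine (Finset.abs_sum_le_sum_abs _ _).trans (Finset.sum_le_sum fun w _ => ?_)
  rw [smul_eq_mul, abs_mul]
  exact mul_le_mul_of_nonneg_left (hM _) (abs_nonneg _)

theorem hasPeriod_of_pow_mem_annihilator {c : ℤ × ℤ → ℤ} {M : ℤ} (hM : ∀ u, |c u| ≤ M)
    {t : ℤ × ℤ} {m : ℕ} (h : (single t 1 - 1) ^ m ∈ annihilator c) : HasPeriod c t := by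
  rw [← single_sub_one_mem_annihilator]
  induction m with
  | zero => rw [← mul_one (single t 1 - 1)]; exact Ideal.mul_mem_left _ _ (by simpa using h)
  | succ m ih =>
    rcases m with _ | k
    · simpa using h
    · refine ih ?_
      rw [pow_succ', mem_annihilator, map_mul, Module.End.mul_apply, ← mem_annihilator]
      -- The square case is applied to `(X^t - 1)^k c`, which is again bounded.
      refine hasPeriod_of_sq_mem_annihilator (abs_action_le hM _) ?_
      rw [mem_annihilator, ← Module.End.mul_apply, ← map_mul, ← pow_add, add_comm 2]
      exact h

theorem single_sub_one_dvd_single_zsmul_sub_one (t : ℤ × ℤ) (l : ℤ) :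
    (single t 1 - 1 : LaurentPoly₂ ℤ) ∣ single (l • t) 1 - 1 := by
  have hnat : ∀ n : ℕ, (single t 1 - 1 : LaurentPoly₂ ℤ) ∣ single ((n : ℤ) • t) 1 - 1 := by
    intro n
    rw [natCast_zsmul]
    simpa [single_pow] using sub_one_dvd_pow_sub_one (single t 1 : LaurentPoly₂ ℤ) n
  obtain ⟨n, rfl | rfl⟩ := l.eq_nat_or_neg
  · exact hnat n
  · have h : (single (-(n : ℤ) • t) 1 - 1 : LaurentPoly₂ ℤ)
        = -single (-(n : ℤ) • t) 1 * (single ((n : ℤ) • t) 1 - 1) := by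
      rw [mul_sub, neg_mul, single_mul_single, ← add_smul, neg_add_cancel, zero_smul, one_mul,
        mul_one, one_def]
      abel
    rw [h]
    exact (hnat n).mul_left _

/-- Differences of exponents of a polynomial in `X^v` are multiples of `v`, so every binomial
obtained from it divides `X^(N v) - 1` for one common multiple `N`. -/
theorem isPeriodicInDirection_of_lineHom_mem {c : ℤ × ℤ → ℤ} {M : ℤ} (hM : ∀ u, |c u| ≤ M)
    {v : ℤ × ℤ} (hv : v ≠ 0) {a : LaurentPolynomial ℤ} (ha0 : a ≠ 0)
    (ha : lineHom v a ∈ annihilator c) : IsPeriodicInDirection c v := by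
  obtain ⟨r, hr, w₀, hw₀, hprod⟩ := exists_prod_single_sub_one_mem_annihilator hM ha
    ((map_ne_zero_iff _ (lineHom_injective hv)).2 ha0)
  set s := (lineHom v a).coeff.support.erase w₀
  have hn : ∀ w, ∃ n : ℤ, w ∈ s → w - w₀ = n • v := by
    intro w
    by_cases hw : w ∈ s
    · obtain ⟨m, hm⟩ := exists_smul_of_mem_support_lineHom (Finset.mem_of_mem_erase hw)
      obtain ⟨m₀, hm₀⟩ := exists_smul_of_mem_support_lineHom hw₀
      exact ⟨m - m₀, fun _ => by rw [hm, hm₀, sub_smul]⟩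
    · exact ⟨0, fun h => absurd h hw⟩
  choose n hn using hn
  have hn0 : ∀ w ∈ s, n w ≠ 0 := fun w hw h =>
    Finset.ne_of_mem_erase hw (sub_eq_zero.1 (by rw [hn w hw, h, zero_smul]))
  refine ⟨∏ w ∈ s, r * n w, Finset.prod_ne_zero_iff.2 fun w hw =>
    mul_ne_zero (by exact_mod_cast hr) (hn0 w hw),
    hasPeriod_of_pow_mem_annihilator hM (m := s.card) ?_⟩
  refine Ideal.mem_of_dvd _ ?_ hprod
  rw [← Finset.prod_const]
  refine Finset.prod_dvd_prod_of_dvd _ _ fun w hw => ?_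
  obtain ⟨l, hl⟩ := Finset.dvd_prod_of_mem (fun w => (r : ℤ) * n w) hw
  rw [hl, mul_comm, mul_smul, hn w hw, ← natCast_zsmul, smul_smul]
  exact single_sub_one_dvd_single_zsmul_sub_one _ l

theorem isPeriodicInDirection_of_formalProduct_const {c : ℤ × ℤ → ℤ} {M : ℤ}
    (hM : ∀ u, |c u| ≤ M) {f : LaurentPoly₂ ℤ} {K : ℤ} (hK : ∀ u, formalProduct f c u = K)
    {v : ℤ × ℤ} (hv : v ≠ 0) (hf : f.AllLineFactorsInDirection v) :
    IsPeriodicInDirection c v := by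
  have hx : (single v 1 - 1 : LaurentPoly₂ ℤ) ≠ 0 := by
    rw [sub_ne_zero, one_def, Ne, single_left_inj one_ne_zero]; exact hv
  -- Every polynomial divides zero, including line polynomials in both axis directions, which cannot
  -- both be parallel to `v`.
  have hf0 : f ≠ 0 := by
    rintro rfl
    have hdet : ∀ u : ℤ × ℤ, IsPrimitiveVector u → det₂ u v = 0 := fun u hu =>
      have hl := isLinePolynomialInDirection_lineHom_cyclotomic hu one_pos
      det₂_eq_zero_of_lineDirections hl (hf _ (dvd_zero _) ⟨u, hl⟩)
    have h1 := hdet (1, 0) isCoprime_one_left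
    have h2 := hdet (0, 1) isCoprime_one_right
    exact hv (Prod.ext (by simpa [det₂] using h2) (by simpa [det₂] using h1))
  have hmem : (single v 1 - 1) * f ∈ annihilator c := by
    rw [mem_annihilator, map_mul, Module.End.mul_apply, action_eq_formalProduct f]
    funext u
    simp [map_sub, action_single, hK]
  obtain ⟨r, hr, w₀, hw₀, hprod⟩ := exists_prod_single_sub_one_mem_annihilator hM hmem
    (mul_ne_zero hx hf0)
  obtain ⟨a, ha0, ha⟩ := exists_lineHom_mem_span_pair_prod (f := f) (v := v) _ _ fun w hw =>
    exists_lineHom_mem_span_pair_single_sub_one (f := f) (u := r • (w - w₀)) (v := v)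
      (smul_ne_zero hr (sub_ne_zero.2 (Finset.ne_of_mem_erase hw))) hv hf
  have hx1 : (single 1 1 - 1 : LaurentPolynomial ℤ) ≠ 0 := by
    rw [sub_ne_zero, one_def, Ne, single_left_inj one_ne_zero]; exact one_ne_zero
  -- Only `(X^v - 1) f` annihilates `c`, not `f`. The extra factor `X^v - 1` handles this and is
  -- itself a polynomial in `X^v`.
  refine isPeriodicInDirection_of_lineHom_mem hM hv (mul_ne_zero hx1 ha0) ?_
  rw [map_mul, map_sub, map_one, lineHom_single, one_smul]
  obtain ⟨x, y, hxy⟩ := Ideal.mem_span_pair.1 ha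
  rw [← hxy, mul_add, mul_left_comm, ← mul_assoc _ y]
  exact Ideal.add_mem _ (Ideal.mul_mem_left _ _ hmem) (Ideal.mul_mem_left _ _ hprod)

theorem isTwoPeriodic_of_formalProduct_const {c : ℤ × ℤ → ℤ} {M : ℤ}
    (hM : ∀ u, |c u| ≤ M) {f : LaurentPoly₂ ℤ} {K : ℤ} (hK : ∀ u, formalProduct f c u = K)
    (hf : f.HasNoLineFactors) : IsTwoPeriodic c := by
  have hall : ∀ v, f.AllLineFactorsInDirection v := fun v φ hφ hline => absurd hline (hf φ hφ)
  obtain ⟨k, hk, hkc⟩ := isPeriodicInDirection_of_formalProduct_const hM hK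
    (v := (1, 0)) (by simp) (hall _)
  obtain ⟨l, hl, hlc⟩ := isPeriodicInDirection_of_formalProduct_const hM hK
    (v := (0, 1)) (by simp) (hall _)
  refine ⟨_, _, ?_, hkc, hlc⟩
  rw [LinearIndependent.pair_iff]
  intro s t hst
  simpa [hk, hl] using hst

/-! ### From abelian complexity one to a constant formal product -/

theorem HasPeriod.of_comp {α β : Type*} {g : α → β} (hg : Function.Injective g) {c : ℤ × ℤ → α}
    {t : ℤ × ℤ} (h : HasPeriod (g ∘ c) t) : HasPeriod c t :=
  funext fun u => hg (congrFun h u)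

/-- The linear functional with weights `g` carries the constant vector product to `f (g ∘ c)`. -/
theorem exists_const_of_abelianComplexity_eq_one {α : Type*} [Fintype α] [DecidableEq α]
    {c : ℤ × ℤ → α} {f : LaurentPoly₂ ℤ} (h : abelianComplexity c f = 1) (g : α → ℤ) :
    ∃ K, ∀ u, formalProduct f (g ∘ c) u = K := by
  obtain ⟨x, hx⟩ := Set.encard_eq_one.1 h
  refine ⟨∑ a, x a * g a, fun u => ?_⟩
  have hu : formalProduct (scalarMatrixPoly α f) (vectorPresentation c) u = x :=
    Set.mem_singleton_iff.1 (hx ▸ Set.mem_range_self u)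
  have hsub : (scalarMatrixPoly α f).coeff.support ⊆ f.coeff.support := by
    intro w hw
    rw [Finsupp.mem_support_iff] at hw ⊢
    intro h0
    exact hw (by rw [scalarMatrixPoly, coeff_mapRingHom, h0, map_zero])
  have hxa : ∀ a, x a = ∑ w ∈ f.coeff.support, f.coeff w * if a = c (u - w) then 1 else 0 := by
    intro a
    rw [← hu, formalProduct, Finset.sum_subset hsub fun w _ hw => by
      rw [Finsupp.notMem_support_iff.1 hw, zero_smul], Finset.sum_apply]
    refine Finset.sum_congr rfl fun w _ => ?_
    simp [scalarMatrixPoly, vectorPresentation, Matrix.intCast_apply]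
  simp_rw [hxa, Finset.sum_mul]
  rw [Finset.sum_comm, formalProduct]
  refine Finset.sum_congr rfl fun w _ => ?_
  simp

theorem sum_comp_eq_sum_occurrences {α : Type*} [Fintype α] {D : Finset (ℤ × ℤ)} (p : D → α)
    (g : α → ℤ) : ∑ x, g (p x) = ∑ a, (occurrences p a : ℤ) * g a := by
  classical
  rw [← Finset.sum_fiberwise Finset.univ p]
  refine Finset.sum_congr rfl fun a _ => ?_
  rw [Finset.sum_congr rfl fun x hx => by rw [(Finset.mem_filter.1 hx).2], Finset.sum_const,
    occurrences, Nat.card_eq_fintype_card, Fintype.card_subtype, nsmul_eq_mul]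

theorem exists_const_of_shapeAbelianComplexity_eq_one {α : Type*} [Fintype α]
    {c : ℤ × ℤ → α} {D : Finset (ℤ × ℤ)} (h : shapeAbelianComplexity c D = 1) (g : α → ℤ) :
    ∃ K, ∀ u, formalProduct (charPoly D) (g ∘ c) u = K := by
  obtain ⟨x, hx⟩ := Set.encard_eq_one.1 h
  set p : ℤ × ℤ → D → α := fun t u => translate t c u
  have hp : ∀ t, Quotient.mk (abelianSetoid α D) (p t) = x := fun t =>
    Set.mem_singleton_iff.1 (hx ▸ Set.mem_image_of_mem _ (Set.mem_range_self t))
  refine ⟨∑ a, (occurrences (p 0) a : ℤ) * g a, fun u => ?_⟩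
  -- Since `charPoly D` has exponents `-w`, its product at `u` sums over the values at `u + w`, that
  -- is, over the pattern of the translate by `-u`.
  have hocc : ∀ a, occurrences (p (-u)) a = occurrences (p 0) a :=
    Quotient.exact ((hp (-u)).trans (hp 0).symm)
  simp_rw [← hocc]
  rw [← sum_comp_eq_sum_occurrences, ← action_eq_formalProduct, charPoly, map_sum,
    LinearMap.sum_apply, Finset.sum_apply, ← Finset.sum_coe_sort]
  refine Finset.sum_congr rfl fun w _ => ?_
  rw [action_single, one_mul]
  simp [p, translate, add_comm]

theorem exists_abs_comp_le {α : Type*} [Finite α] (g : α → ℤ) (c : ℤ × ℤ → α) :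
    ∃ M, ∀ u, |(g ∘ c) u| ≤ M := by
  obtain ⟨M, hM⟩ := (Set.finite_range fun a => |g a|).bddAbove
  exact ⟨M, fun u => hM (Set.mem_range_self (c u))⟩

end Configuration₂

open Configuration₂

theorem mainTheorem4 :
    (∀ (A : Finset ℤ) (c : ℤ × ℤ → A) (f : LaurentPoly₂ ℤ),
      Configuration₂.abelianComplexity c f = 1 →
        (LaurentPoly₂.HasNoLineFactors f → Configuration₂.IsTwoPeriodic c) ∧
        (∀ v : ℤ × ℤ, IsPrimitiveVector v → LaurentPoly₂.AllLineFactorsInDirection f v →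
          Configuration₂.IsPeriodicInDirection c v)) ∧
    (∀ (α : Type*) [Finite α] (c : ℤ × ℤ → α) (D : Finset (ℤ × ℤ)),
      Configuration₂.shapeAbelianComplexity c D = 1 →
        (LaurentPoly₂.HasNoLineFactors (LaurentPoly₂.charPoly D) →
          Configuration₂.IsTwoPeriodic c) ∧
        ((∃ v : ℤ × ℤ, IsPrimitiveVector v ∧
            LaurentPoly₂.AllLineFactorsInDirection (LaurentPoly₂.charPoly D) v) →
          Configuration₂.IsPeriodic c)) := by
  have hprim : ∀ v : ℤ × ℤ, IsPrimitiveVector v → v ≠ 0 := by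
    rintro _ hv rfl
    exact not_isCoprime_zero_zero hv
  refine ⟨fun A c f h => ?_, fun α _ c D h => ?_⟩
  · have hinj : Function.Injective (Subtype.val : A → ℤ) := Subtype.val_injective
    obtain ⟨M, hM⟩ := exists_abs_comp_le (Subtype.val : A → ℤ) c
    obtain ⟨K, hK⟩ := exists_const_of_abelianComplexity_eq_one h Subtype.val
    refine ⟨fun hf => ?_, fun v hv hf => ?_⟩
    · obtain ⟨s, t, hst, hs, ht⟩ := isTwoPeriodic_of_formalProduct_const hM hK hf
      exact ⟨s, t, hst, hs.of_comp hinj, ht.of_comp hinj⟩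
    · obtain ⟨k, hk, hkc⟩ := isPeriodicInDirection_of_formalProduct_const hM hK (hprim v hv) hf
      exact ⟨k, hk, hkc.of_comp hinj⟩
  · have := Fintype.ofFinite α
    -- Any injective integer coding works: it gives a bounded configuration with the same periods.
    set g : α → ℤ := fun a => Fintype.equivFin α a
    have hinj : Function.Injective g := fun a b hab =>
      (Fintype.equivFin α).injective (Fin.ext (by simpa [g] using hab))
    obtain ⟨M, hM⟩ := exists_abs_comp_le g c
    obtain ⟨K, hK⟩ := exists_const_of_shapeAbelianComplexity_eq_one h g
    refine ⟨fun hf => ?_, fun ⟨v, hv, hf⟩ => ?_⟩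
    · obtain ⟨s, t, hst, hs, ht⟩ := isTwoPeriodic_of_formalProduct_const hM hK hf
      exact ⟨s, t, hst, hs.of_comp hinj, ht.of_comp hinj⟩
    · obtain ⟨k, hk, hkc⟩ := isPeriodicInDirection_of_formalProduct_const hM hK (hprim v hv) hf
      exact ⟨k • v, smul_ne_zero hk (hprim v hv), hkc.of_comp hinj⟩
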